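/- **Setting.** *Machine.* Addresses are 64-bit, memory is an array of bytes, there are 16 general-purpose registers and four bound registers, each holding a lower and an upper bound. Instructions are encoded by an arbitrary prefix-free code of byte strings (as for x86-64). They are: $\mathtt{nop}$; the load $\mathtt{mov\ (src),dst}$; the bound checks $\mathtt{bndcl}$, $\mathtt{bndcu}$, which raise an exception if a value is below the lower, respectively above the upper bound; direct control transfers ($\mathtt{jmp}$, conditional jump, $\mathtt{call}$ with a hard-coded displacement); register-based indirect transfers ($\mathtt{jmp}$ or $\mathtt{call}$ to the address in a register); memory-based indirect transfers; returns; dangerous instructions (SGX instructions, instructions that modify bound registers, and miscellaneous ones such as $\mathtt{xrstor}$), whose effect is arbitrary; and all others, which proceed to the next instruction and do not change bound registers, but whose effect on registers and memory is arbitrary. A $\mathtt{cfi\_label}$ with ID $x$ is an 8-byte $\mathtt{nop}$ whose first four bytes are a fixed string $m$ and whose last four bytes are $x$. A $\mathtt{cfi\_guard}$ on a register $r$ is the sequence $\mathtt{mov\ (}r\mathtt{)},s;\ \mathtt{bndcl}\ s,\mathtt{bnd1};\ \mathtt{bndcu}\ s,\mathtt{bnd1}$ with a scratch register $s\ne r$;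 a $\mathtt{mem\_guard}$ is the check of a memory operand against both bounds of $\mathtt{bnd0}$. *Verifier.* Stage 1 disassembles a code segment, treating $\mathtt{cfi\_label}$, $\mathtt{cfi\_guard}$, $\mathtt{mem\_guard}$ as single instructions. It starts from all occurrences of $m$, follows sequential execution up to unconditional transfers and the targets of all direct transfers, and aborts at addresses outside of the segment, at invalid instructions, and at instructions that overlap others found before. If it completes, it yields the set $R$ of instructions found. Stage 2 checks that $R$ contains no dangerous instruction. Stage 3 checks that no direct transfer in $R$ targets a register-based indirect transfer, that each register-based indirect transfer in $R$ is immediately preceded by a $\mathtt{cfi\_guard}$ in $R$ on the same register, and that $R$ contains no memory-based transfer and no return. *Enclave.* There are several domains with pairwise distinct 4-byte IDs, such that $m$ never occurs starting strictly inside a $\mathtt{cfi\_label}$ of a domain. Each domain has a code region $[C.\mathit{begin},C.\mathit{end})$ and a non-executable data region $[D.\mathit{begin},D.\mathit{end})$, followed by guard regions; the memory ranges of the domains and the code of the LibOS are disjoint. Instructions can be fetched only from code regions and from the code of the LibOS; elsewhere a fetch raises an exception. To load a binary, the LibOS copies its code segment to the beginning of the code region, with the last four bytes of all $\mathtt{cfi\_label}$s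 replaced by the ID of the domain, and inserts behind it, in the code region, a trusted trampoline for system calls, which begins with a $\mathtt{cfi\_label}$ of the domain. Executable memory contains no $\mathtt{cfi\_label}$ of a domain other than those at the beginnings of trampolines and those whose first four bytes lie in a loaded code segment. *Execution.* Whenever the LibOS passes control to a domain (at the start, or after a system call or an exception) it does so at a $\mathtt{cfi\_label}$ of this domain in its code region, with $\mathtt{bnd0}$ set to the data region and with both bounds of $\mathtt{bnd1}$ equal to the 64-bit value of the $\mathtt{cfi\_label}$ of the domain. Between the instructions of the domain, memory may be modified by others. Throughout the execution, the code segment loaded in the domain is not modified, and every domain holds code that passes Stages 1–3 (possibly none), loaded as above. The trampoline is trusted and does not count as code executed by the domain. **Theorem.** Suppose that a binary passes Stages 1–3 of the verifier and is loaded into a domain by the LibOS. Then, in every execution of this domain: 1. every register-based indirect control transfer that is executed jumps to a $\mathtt{cfi\_label}$ of the domain, lying within its code region $[C.\mathit{begin},C.\mathit{end})$, unless it is detected, i.e. its target is not executable, so that an exception is raised before anything is executed at the target; 2. every control transfer instruction that is executed transfers control to an address within $[C.\mathit{begin},C.\mathit{end})$, unless it is a register-based indirect transfer that is detected in this sense.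 -/

import Mathlib

/-!
An operational model of MPX-based multi-domain software fault isolation: machine code, the
first three stages of the binary verifier, the loader and memory layout maintained by the LibOS,
and the execution of a domain.
-/

namespace Mmdsfi

/-! ## Machine state -/

abbrev Byte := BitVec 8
abbrev Addr := BitVec 64
/-- The sixteen general-purpose registers. -/
abbrev Reg := Fin 16
/-- The four MPX bound registers. -/
abbrev BndReg := Fin 4
abbrev Mem := Addr → Byte

/-- The address with numerical value `n`. -/
def addr (n : ℕ) : Addr := BitVec.ofNat 64 n

structure State where
  pc : Addr
  regs : Reg → Addr
  /-- lower and (inclusive) upper bound held in each MPX bound register -/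
  bnd : BndReg → Addr × Addr
  mem : Mem

/-- The `n` bytes of memory starting at `a`. -/
def readBytes (mem : Mem) (a : Addr) (n : ℕ) : List Byte :=
  (List.range n).map fun j => mem (a + addr j)

/-- Little-endian 64-bit value of eight bytes. -/
def le64 (b : Fin 8 → Byte) : BitVec 64 :=
  b 7 ++ b 6 ++ b 5 ++ b 4 ++ b 3 ++ b 2 ++ b 1 ++ b 0

def load64 (mem : Mem) (a : Addr) : BitVec 64 :=
  le64 fun j => mem (a + addr j)

/-! ## Instructions -/

/-- Memory operand `disp(base, index, scale)`. -/
structure MemOperand where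
  base : Option Reg
  index : Option Reg
  scale : ℕ
  disp : Addr

/-- Operand of an MPX bound check. -/
inductive BndOperand where
  | reg (r : Reg)
  | mem (m : MemOperand)

/-- The address that a bound check compares with the bounds. -/
def BndOperand.value (s : State) : BndOperand → Addr
  | .reg r => s.regs r
  | .mem m => (m.base.elim 0 s.regs) + (m.index.elim 0 s.regs) * addr m.scale + m.disp

/-- The three classes of instructions that are reserved for the LibOS. -/
inductive DangerClass where
  /-- SGX instructions, such as `eexit`, `emodpe`, `eaccept` -/
  | sgx
  /-- MPX instructions that modify bound registers, such as `bndmk`, `bndmov` -/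
  | mpx
  /-- miscellaneous ones, such as `xrstor`, `wrfsbase`, `wrgsbase` -/
  | misc

/-- The instructions of the processor. Those that matter neither for control flow nor for the
bound registers are collected in `other`. -/
inductive Instr where
  | nop
  /-- `mov (%src), %dst` with 64-bit operands -/
  | load (dst src : Reg)
  /-- check against the lower bound -/
  | bndcl (b : BndReg) (x : BndOperand)
  /-- check against the upper bound -/
  | bndcu (b : BndReg) (x : BndOperand)
  /-- direct transfers; the displacement is relative to the next instruction -/
  | jmp (disp : ℤ)
  | jcc (disp : ℤ)
  | call (disp : ℤ)
  /-- register-based indirect transfers -/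
  | jmpReg (r : Reg)
  | callReg (r : Reg)
  /-- memory-based indirect transfers -/
  | jmpMem
  | callMem
  /-- return-based indirect transfers -/
  | ret
  | dangerous (k : DangerClass)
  | other

namespace Instr

/-- Displacement of a direct control transfer. -/
def directDisp : Instr → Option ℤ
  | jmp d => some d
  | jcc d => some d
  | call d => some d
  | _ => none

/-- Register that holds the target of a register-based indirect control transfer. -/
def targetReg : Instr → Option Reg
  | jmpReg r => some r
  | callReg r => some r
  | _ => none

def IsDirect (i : Instr) : Prop := i.directDisp.isSome
def IsRegBased (i : Instr) : Prop := i.targetReg.isSome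
def IsMemBased (i : Instr) : Prop := i = jmpMem ∨ i = callMem
def IsReturn (i : Instr) : Prop := i = ret

def IsControlTransfer (i : Instr) : Prop :=
  i.IsDirect ∨ i.IsRegBased ∨ i.IsMemBased ∨ i.IsReturn

def IsUnconditional (i : Instr) : Prop :=
  i.IsControlTransfer ∧ ∀ d, i ≠ jcc d

end Instr

/-- A variable-length instruction encoding, such as that of x86-64: a prefix-free code of byte
strings. `magic` is the first half of the encoding of `cfi_label`, which is an 8-byte `nop`
whose last four bytes can be chosen freely. -/
structure InstrSet where
  enc : List Byte → Option Instr
  enc_nil : enc [] = none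
  prefix_free : ∀ u v : List Byte, (enc u).isSome → (enc (u ++ v)).isSome → v = []
  magic : Fin 4 → Byte
  enc_label : ∀ id : Fin 4 → Byte,
    enc (List.ofFn (Fin.append magic id : Fin 8 → Byte)) = some Instr.nop

/-- The 8-byte encoding of the `cfi_label` of the domain with the given ID. -/
def InstrSet.label (X : InstrSet) (id : Fin 4 → Byte) : Fin 8 → Byte :=
  Fin.append X.magic id

/-- The effect of an instruction `i` of length `n` that executes without exception. Wherever a
component of the new state is not mentioned, it is unconstrained. -/
def Effect (i : Instr) (n : ℕ) (s s' : State) : Prop :=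
  match i with
  | .nop => s' = { s with pc := s.pc + addr n }
  | .load dst src =>
      s' = { s with
        pc := s.pc + addr n
        regs := Function.update s.regs dst (load64 s.mem (s.regs src)) }
  | .bndcl b x => (s.bnd b).1 ≤ x.value s ∧ s' = { s with pc := s.pc + addr n }
  | .bndcu b x => x.value s ≤ (s.bnd b).2 ∧ s' = { s with pc := s.pc + addr n }
  | .jmp d => s'.pc = s.pc + addr n + BitVec.ofInt 64 d ∧ s'.bnd = s.bnd
  | .jcc d =>
      (s'.pc = s.pc + addr n + BitVec.ofInt 64 d ∨ s'.pc = s.pc + addr n) ∧ s'.bnd = s.bnd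
  | .call d => s'.pc = s.pc + addr n + BitVec.ofInt 64 d ∧ s'.bnd = s.bnd
  | .jmpReg r => s'.pc = s.regs r ∧ s'.bnd = s.bnd
  | .callReg r => s'.pc = s.regs r ∧ s'.bnd = s.bnd
  | .jmpMem => s'.bnd = s.bnd
  | .callMem => s'.bnd = s.bnd
  | .ret => s'.bnd = s.bnd
  | .dangerous _ => True
  | .other => s'.pc = s.pc + addr n ∧ s'.bnd = s.bnd

/-! ## The verifier

Its input is the code segment `C : List Byte` of a binary. Addresses are offsets in `C`. -/

/-- Machine instructions together with the pseudo-instructions known to the disassembler. -/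
inductive Op where
  | cfiLabel
  /-- `mov (%reg), %scratch; bndcl %scratch, %bnd1; bndcu %scratch, %bnd1` -/
  | cfiGuard (reg scratch : Reg)
  /-- `bndcl m, %bnd0; bndcu m, %bnd0` -/
  | memGuard (m : MemOperand)
  | machine (i : Instr)

/-- A disassembled instruction. -/
structure DInstr where
  pos : ℕ
  len : ℕ
  op : Op

def DInstr.Overlaps (i j : DInstr) : Prop :=
  i.pos < j.pos + j.len ∧ j.pos < i.pos + i.len

def DInstr.machine? (i : DInstr) : Option Instr :=
  match i.op with
  | .machine m => some m
  | _ => none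

/-- Target offset of a direct control transfer. -/
def DInstr.directTarget (i : DInstr) : Option ℤ :=
  i.machine?.bind fun m => m.directDisp.map fun d => (i.pos : ℤ) + i.len + d

def DInstr.IsUnconditional (i : DInstr) : Prop :=
  ∃ m, i.op = .machine m ∧ m.IsUnconditional

/-- There is a `cfi_label` at offset `o`. As its last four bytes are rewritten by the loader, it
is recognized by its first four. -/
def LabelPos (X : InstrSet) (C : List Byte) (o : ℕ) : Prop :=
  ∀ j : Fin 4, C[o + (j : ℕ)]? = some (X.magic j)

/-- The machine instruction `i` of length `n` stands at offset `o`. -/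
def MachineAt (X : InstrSet) (C : List Byte) (o : ℕ) (i : Instr) (n : ℕ) : Prop :=
  o + n ≤ C.length ∧ X.enc ((C.drop o).take n) = some i

def CfiGuardAt (X : InstrSet) (C : List Byte) (o : ℕ) (r s : Reg) (n : ℕ) : Prop :=
  s ≠ r ∧ ∃ n₁ n₂ n₃, n = n₁ + n₂ + n₃ ∧
    MachineAt X C o (.load s r) n₁ ∧
    MachineAt X C (o + n₁) (.bndcl 1 (.reg s)) n₂ ∧
    MachineAt X C (o + n₁ + n₂) (.bndcu 1 (.reg s)) n₃

def MemGuardAt (X : InstrSet) (C : List Byte) (o : ℕ) (m : MemOperand) (n : ℕ) : Prop :=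
  ∃ n₁ n₂, n = n₁ + n₂ ∧
    MachineAt X C o (.bndcl 0 (.mem m)) n₁ ∧
    MachineAt X C (o + n₁) (.bndcu 0 (.mem m)) n₂

/-- The extended disassembler: a pseudo-instruction is preferred to the machine instruction with
which it begins. -/
inductive Disasm (X : InstrSet) (C : List Byte) : DInstr → Prop where
  | label (o : ℕ) : LabelPos X C o → o + 8 ≤ C.length → Disasm X C ⟨o, 8, .cfiLabel⟩
  | cfiGuard (o n : ℕ) (r s : Reg) : CfiGuardAt X C o r s n → Disasm X C ⟨o, n, .cfiGuard r s⟩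
  | memGuard (o n : ℕ) (m : MemOperand) : MemGuardAt X C o m n → Disasm X C ⟨o, n, .memGuard m⟩
  | machine (o n : ℕ) (i : Instr) : MachineAt X C o i n → ¬ LabelPos X C o →
      (¬ ∃ r s n', CfiGuardAt X C o r s n') → (¬ ∃ m n', MemGuardAt X C o m n') →
      Disasm X C ⟨o, n, .machine i⟩

/-- State of the disassembly algorithm: the set `R` of instructions found so far, the set `S` of
addresses still to be visited, and the address `cur` of the inner loop, if that is running. -/
structure DisasmState where
  R : Set DInstr
  S : Set ℤ
  cur : Option ℤ

/-- One step of the disassembly algorithm. Where the algorithm aborts (address outside of the code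
segment, invalid instruction, overlapping instruction) there is no step. -/
inductive DisasmStep (X : InstrSet) (C : List Byte) : DisasmState → DisasmState → Prop where
  | pop (R : Set DInstr) (S : Set ℤ) (a : ℤ) : a ∈ S →
      DisasmStep X C ⟨R, S, none⟩ ⟨R, S \ {a}, some a⟩
  | seen (R : Set DInstr) (S : Set ℤ) (i : DInstr) : i.pos < C.length → Disasm X C i → i ∈ R →
      DisasmStep X C ⟨R, S, some (i.pos : ℤ)⟩ ⟨R, S, none⟩
  | last (R : Set DInstr) (S : Set ℤ) (i : DInstr) : i.pos < C.length → Disasm X C i → i ∉ R →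
      (∀ j ∈ R, ¬ i.Overlaps j) → i.IsUnconditional →
      DisasmStep X C ⟨R, S, some (i.pos : ℤ)⟩
        ⟨insert i R, S ∪ {t | i.directTarget = some t}, none⟩
  | next (R : Set DInstr) (S : Set ℤ) (i : DInstr) : i.pos < C.length → Disasm X C i → i ∉ R →
      (∀ j ∈ R, ¬ i.Overlaps j) → ¬ i.IsUnconditional →
      DisasmStep X C ⟨R, S, some (i.pos : ℤ)⟩
        ⟨insert i R, S ∪ {t | i.directTarget = some t}, some ((i.pos : ℤ) + i.len)⟩

/-- Stage 1: the disassembly, started from all `cfi_label`s, runs to completion and yields `R`. -/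
def Stage1 (X : InstrSet) (C : List Byte) (R : Set DInstr) : Prop :=
  Relation.ReflTransGen (DisasmStep X C)
    ⟨∅, {a | ∃ o : ℕ, a = o ∧ LabelPos X C o}, none⟩ ⟨R, ∅, none⟩

/-- Stage 2: no dangerous instruction. -/
def Stage2 (R : Set DInstr) : Prop :=
  ∀ i ∈ R, ∀ k, i.op ≠ .machine (.dangerous k)

/-- Stage 3: verification of each control transfer by category. -/
structure Stage3 (R : Set DInstr) : Prop where
  /-- a direct transfer does not jump to a register-based indirect transfer -/
  direct : ∀ i ∈ R, ∀ t, i.directTarget = some t →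
    ∀ j ∈ R, (j.pos : ℤ) = t → ∀ m, j.op = .machine m → ¬ m.IsRegBased
  /-- a register-based indirect transfer is immediately preceded by a `cfi_guard` on its register -/
  regBased : ∀ i ∈ R, ∀ m r, i.op = .machine m → m.targetReg = some r →
    ∃ g ∈ R, (∃ s, g.op = .cfiGuard r s) ∧ g.pos + g.len = i.pos
  memBased : ∀ i ∈ R, ∀ m, i.op = .machine m → ¬ m.IsMemBased
  returnBased : ∀ i ∈ R, ∀ m, i.op = .machine m → ¬ m.IsReturn

/-- The code segment `C` passes Stages 1 to 3. -/
def PassesStages123 (X : InstrSet) (C : List Byte) : Prop :=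
  ∃ R, Stage1 X C R ∧ Stage2 R ∧ Stage3 R

/-! ## Domains and the LibOS -/

/-- A domain: its ID, its code region `[codeBegin, codeEnd)`, its data region
`[dataBegin, dataEnd)`, and, in the code region, the trampoline
`[tramp, tramp + trampLen)` through which system calls are made. -/
structure Domain where
  id : Fin 4 → Byte
  codeBegin : ℕ
  codeEnd : ℕ
  dataBegin : ℕ
  dataEnd : ℕ
  tramp : ℕ
  trampLen : ℕ

def Domain.InCode (d : Domain) (a : Addr) : Prop := d.codeBegin ≤ a.toNat ∧ a.toNat < d.codeEnd

def Domain.InTramp (d : Domain) (a : Addr) : Prop :=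
  d.tramp ≤ a.toNat ∧ a.toNat < d.tramp + d.trampLen

/-- The eight bytes at `a` are the `cfi_label` with the given ID. -/
def LabelAt (X : InstrSet) (mem : Mem) (a : Addr) (id : Fin 4 → Byte) : Prop :=
  ∀ j : Fin 8, mem (a + addr j) = X.label id j

/-- The enclave: the slots `ι` for domains and the code of the LibOS. -/
structure Enclave (X : InstrSet) (ι : Type*) where
  dom : ι → Domain
  libosCode : Set Addr
  guardSize : ℕ
  code_le : ∀ d, (dom d).codeBegin ≤ (dom d).codeEnd
  /-- the code region is followed by a guard region, the data region and a guard region -/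
  data_eq : ∀ d, (dom d).dataBegin = (dom d).codeEnd + guardSize
  data_lt : ∀ d, (dom d).dataBegin < (dom d).dataEnd
  bounded : ∀ d, (dom d).dataEnd + guardSize ≤ 2 ^ 64
  disjoint : ∀ d e, d ≠ e →
    (dom d).dataEnd + guardSize ≤ (dom e).codeBegin ∨
    (dom e).dataEnd + guardSize ≤ (dom d).codeBegin
  libos_disjoint : ∀ d, ∀ a ∈ libosCode,
    a.toNat < (dom d).codeBegin ∨ (dom d).dataEnd + guardSize ≤ a.toNat
  tramp_mem : ∀ d, (dom d).codeBegin ≤ (dom d).tramp ∧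
    8 ≤ (dom d).trampLen ∧ (dom d).tramp + (dom d).trampLen ≤ (dom d).codeEnd
  /-- IDs are unique -/
  id_injective : Function.Injective fun d => (dom d).id
  /-- a domain ID is such that writing it into a label does not create the beginning of another
  label: no occurrence of `magic` can start strictly inside a label -/
  id_safe : ∀ d, ∀ j : ℕ, 1 ≤ j → j < 8 →
    ¬ ∀ (i : Fin 4) (h : j + i < 8), X.label (dom d).id ⟨j + i, h⟩ = X.magic i

section
variable {X : InstrSet} {ι : Type*}

/-- Addresses from which instructions can be fetched inside of the enclave. In particular the data
and guard regions of domains are not executable. -/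
def Enclave.Executable (E : Enclave X ι) (a : Addr) : Prop :=
  (∃ d, (E.dom d).InCode a) ∨ a ∈ E.libosCode

/-- An instruction fetch from `a` raises an exception, which is handled by the LibOS: this is how a
control transfer to `a` is detected before anything is executed at `a`. -/
def Enclave.FetchFaults (E : Enclave X ι) (a : Addr) : Prop := ¬ E.Executable a

/-- The code segment `C` has been loaded into the code region of the domain `d`, with the last four
bytes of all `cfi_label`s rewritten to the ID of `d`, and the trampoline has been inserted, at a
`cfi_label` of `d`. -/
structure Loaded (X : InstrSet) (d : Domain) (C : List Byte) (mem : Mem) : Prop where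
  fits : d.codeBegin + C.length ≤ d.tramp
  labels : ∀ o, LabelPos X C o → ∀ j : Fin 4, mem (addr (d.codeBegin + (o + 4 + j))) = d.id j
  code : ∀ i (h : i < C.length), (∀ o, LabelPos X C o → ¬ (o + 4 ≤ i ∧ i < o + 8)) →
    mem (addr (d.codeBegin + i)) = C[i]
  tramp : LabelAt X mem (addr d.tramp) d.id

/-- What the LibOS guarantees for the executable memory while the code segment `C` is loaded in the
domain `d`: that code is intact, every domain holds verified code (possibly none at all), and
elsewhere, that is in the code of the LibOS, in trampolines and in unused parts of code regions,
there is no `cfi_label` apart from those at which the trampolines begin. -/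
def Enclave.CodeIntact (E : Enclave X ι) (d : ι) (C : List Byte) (mem : Mem) : Prop :=
  ∃ img : ι → List Byte, img d = C ∧
    (∀ e, PassesStages123 X (img e) ∧ Loaded X (E.dom e) (img e) mem) ∧
    ∀ a e, E.Executable a → LabelAt X mem a (E.dom e).id →
      (∃ e', a = addr (E.dom e').tramp) ∨
      (∃ e', (E.dom e').codeBegin ≤ a.toNat ∧
        a.toNat + 4 ≤ (E.dom e').codeBegin + (img e').length)

/-! ## Execution of a domain -/

/-- The LibOS passes control to the domain `d`: at a `cfi_label` of `d`, with the bound register 0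
set to the data region and the bound register 1 to the `cfi_label` of `d`. -/
structure Enclave.Entry (E : Enclave X ι) (d : ι) (s : State) : Prop where
  pc_mem : (E.dom d).InCode s.pc
  pc_label : LabelAt X s.mem s.pc (E.dom d).id
  bnd0 : s.bnd 0 = (addr (E.dom d).dataBegin, addr ((E.dom d).dataEnd - 1))
  bnd1 : s.bnd 1 = (le64 (X.label (E.dom d).id), le64 (X.label (E.dom d).id))

/-- What happens in a step of an execution. -/
inductive Action where
  /-- the domain executes the instruction `i` of length `n` -/
  | user (i : Instr) (n : ℕ)
  /-- memory is modified from elsewhere: other threads, other domains, the host, the LibOS -/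
  | env
  /-- the LibOS (re)enters the domain, after a system call or an exception -/
  | libos

/-- The domain `d` executes the instruction `i`, fetched from executable memory. The trampoline is
not code of the domain, but part of the trusted system call path. -/
structure Enclave.UserStep (E : Enclave X ι) (d : ι) (i : Instr) (n : ℕ) (s s' : State) :
    Prop where
  fetch : ∀ j < n, E.Executable (s.pc + addr j)
  decode : X.enc (readBytes s.mem s.pc n) = some i
  not_tramp : ¬ (E.dom d).InTramp s.pc
  effect : Effect i n s s'

def Enclave.Step (E : Enclave X ι) (d : ι) : Action → State → State → Prop
  | .user i n, s, s' => E.UserStep d i n s s'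
  | .env, s, s' => s'.pc = s.pc ∧ s'.regs = s.regs ∧ s'.bnd = s.bnd
  | .libos, _, s' => E.Entry d s'

/-- `s 0, …, s N` is an execution of the domain `d`, in which the code segment `C` is loaded, with
the actions `act 0, …, act (N - 1)`. -/
structure Enclave.IsTrace (E : Enclave X ι) (d : ι) (C : List Byte) (N : ℕ)
    (s : ℕ → State) (act : ℕ → Action) : Prop where
  init : E.Entry d (s 0)
  step : ∀ k < N, E.Step d (act k) (s k) (s (k + 1))
  intact : ∀ k ≤ N, E.CodeIntact d C (s k).mem

/-- `a` is the address of a `cfi_label` of the domain `d`, inside of its code region. -/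
def Enclave.IsCfiLabel (E : Enclave X ι) (d : ι) (mem : Mem) (a : Addr) : Prop :=
  LabelAt X mem a (E.dom d).id ∧
    (E.dom d).codeBegin ≤ a.toNat ∧ a.toNat + 8 ≤ (E.dom d).codeEnd

end

end Mmdsfi

namespace Mmdsfi

/-! The proof is an invariant on states: `bnd1` holds the domain's label value, and the program
counter is at an address that cannot be fetched, at the start of the trampoline, at the start of an
instruction of the disassembly `R`, or inside a guard of `R` (`Location`). A register-based transfer
must in addition hold a safe target in its register: an address that is not executable, or a label
of this domain.

Control cannot leave `R`. `R` is closed under sequential execution and direct transfers and contains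
all labels (`Stage1.isDisassembly`). Its instructions are disjoint, so the loader's rewriting
touches only labels, which decode to `nop` for every ID; memory therefore executes what was
disassembled (`UserStep.instr_eq`).

A register-based transfer is reached only by falling through its `cfi_guard`, since neither a direct
transfer nor a label leads to it. Both bounds of `bnd1` coincide, so passing the guard means that
the eight loaded bytes were the label of the domain. If such an address is executable, it is one of
the domain's own labels (`CodeIntact.isLoadedLabel`), by uniqueness and safety of IDs. "Own label"
refers only to `C` and the layout, not to memory, so the conclusion survives memory changes between
the load and the transfer.

`UserStep.inv` preserves the invariant along user instructions and yields the transfer property. -/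

/-! ### Address arithmetic and byte sequences. -/

theorem addr_add (a b : ℕ) : addr a + addr b = addr (a + b) := by
  simp [addr, BitVec.ofNat_add]

theorem toNat_addr {a : ℕ} (h : a < 2 ^ 64) : (addr a).toNat = a := by
  simp only [addr, BitVec.toNat_ofNat]
  exact Nat.mod_eq_of_lt h

theorem eq_addr_toNat (a : Addr) : a = addr a.toNat := by
  simp [addr]

theorem addr_add_ofInt (a b : ℕ) (d : ℤ) (h : (a : ℤ) + d = b) :
    addr a + BitVec.ofInt 64 d = addr b := by
  rw [addr, addr, ← BitVec.ofInt_natCast, ← BitVec.ofInt_natCast, ← BitVec.ofInt_add, h]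

theorem append_inj {v w : ℕ} {x x' : BitVec v} {y y' : BitVec w} (h : x ++ y = x' ++ y') :
    x = x' ∧ y = y' := by
  constructor
  · rw [← BitVec.extractLsb'_append_eq_left (a := x) (b := y), h,
      BitVec.extractLsb'_append_eq_left]
  · rw [← BitVec.extractLsb'_append_eq_right (a := x) (b := y), h,
      BitVec.extractLsb'_append_eq_right]

/-- Lets the numerical comparison in a guard recover the individual bytes of the label. -/
theorem le64_injective : Function.Injective le64 := by
  intro b c h
  obtain ⟨h, h0⟩ := append_inj h
  obtain ⟨h, h1⟩ := append_inj h
  obtain ⟨h, h2⟩ := append_inj h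
  obtain ⟨h, h3⟩ := append_inj h
  obtain ⟨h, h4⟩ := append_inj h
  obtain ⟨h, h5⟩ := append_inj h
  obtain ⟨h7, h6⟩ := append_inj h
  funext j
  fin_cases j <;> assumption

theorem length_readBytes (mem : Mem) (a : Addr) (n : ℕ) : (readBytes mem a n).length = n := by
  simp [readBytes]

theorem readBytes_add (mem : Mem) (a : Addr) (m n : ℕ) :
    readBytes mem a (m + n) = readBytes mem a m ++ readBytes mem (a + addr m) n := by
  simp [readBytes, List.range_add, add_assoc, addr_add]

/-! ### Consequences of prefix-freeness -/

theorem InstrSet.enc_eq_of_prefix (X : InstrSet) {u v : List Byte} {i j : Instr}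
    (hu : X.enc u = some i) (hv : X.enc v = some j) (h : u <+: v) : u = v ∧ i = j := by
  obtain ⟨w, rfl⟩ := h
  have := X.prefix_free u w (by simp [hu]) (by simp [hv])
  subst this
  simp_all

/-- Two readings from one address are comparable as prefixes, so a prefix-free code admits at most
one of them. -/
theorem InstrSet.decode_unique (X : InstrSet) {mem : Mem} {a : Addr} {m n : ℕ} {i j : Instr}
    (hi : X.enc (readBytes mem a m) = some i) (hj : X.enc (readBytes mem a n) = some j) :
    m = n ∧ i = j := by
  have aux : ∀ {m n : ℕ} {i j : Instr}, m ≤ n → X.enc (readBytes mem a m) = some i →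
      X.enc (readBytes mem a n) = some j → m = n ∧ i = j := by
    intro m n i j hmn hi hj
    obtain ⟨k, rfl⟩ := Nat.exists_eq_add_of_le hmn
    have := X.enc_eq_of_prefix hi hj ⟨_, (readBytes_add mem a m k).symm⟩
    refine ⟨?_, this.2⟩
    simpa [length_readBytes] using congrArg List.length this.1
  rcases le_total m n with h | h
  · exact aux h hi hj
  · obtain ⟨h1, h2⟩ := aux h hj hi
    exact ⟨h1.symm, h2.symm⟩

theorem InstrSet.decode_pos (X : InstrSet) {mem : Mem} {a : Addr} {n : ℕ} {i : Instr}
    (h : X.enc (readBytes mem a n) = some i) : 0 < n := by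
  rcases Nat.eq_zero_or_pos n with rfl | h0
  · simp [readBytes, X.enc_nil] at h
  · exact h0

theorem MachineAt.pos {X : InstrSet} {C : List Byte} {o n : ℕ} {i : Instr}
    (h : MachineAt X C o i n) : 0 < n := by
  rcases Nat.eq_zero_or_pos n with rfl | h0
  · simp [MachineAt, X.enc_nil] at h
  · exact h0

/-- Whatever the ID bytes are, a full label decodes to `nop`, and prefix-freeness excludes any
shorter or longer instruction with a different meaning. In particular no guard begins at a label. -/
theorem MachineAt.eq_nop_of_labelPos {X : InstrSet} {C : List Byte} {o n : ℕ} {i : Instr}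
    (h : MachineAt X C o i n) (hl : LabelPos X C o) : i = .nop := by
  obtain ⟨hn, he⟩ := h
  -- The segment may end inside the label; the missing ID bytes are filled with `0`, which is
  -- harmless because every ID gives a `nop`.
  let w : Fin 8 → Byte := Fin.append X.magic fun j : Fin 4 => (C[o + 4 + (j : ℕ)]?).getD 0
  have hw : X.enc (List.ofFn w) = some .nop := X.enc_label _
  have hwj : ∀ j (hj : j < 8), o + j < C.length → C[o + j]? = some (w ⟨j, hj⟩) := by
    intro j hj hlt
    rcases lt_or_ge j 4 with h4 | h4
    · have := hl ⟨j, h4⟩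
      have e : (⟨j, hj⟩ : Fin 8) = Fin.castAdd 4 ⟨j, h4⟩ := rfl
      simp only [w, e, Fin.append_left, this]
    · have e : (⟨j, hj⟩ : Fin 8) = Fin.natAdd 4 (⟨j - 4, by omega⟩ : Fin 4) := by
        ext; simp; omega
      simp only [w, e, Fin.append_right]
      have : o + 4 + (j - 4) = o + j := by omega
      simp [this, hlt]
  rcases le_total n 8 with h8 | h8
  · refine (X.enc_eq_of_prefix he hw ?_).2
    rw [List.prefix_iff_eq_take]
    apply List.ext_getElem?
    intro j
    simp only [List.getElem?_take, List.getElem?_drop, List.length_take, List.length_drop]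
    by_cases hj : j < n
    · have h1 : j < min n (C.length - o) := by omega
      rw [if_pos hj, if_pos h1, hwj j (by omega) (by omega), List.getElem?_ofFn,
        dif_pos (by omega)]
    · rw [if_neg hj, if_neg]
      omega
  · refine (X.enc_eq_of_prefix hw he ?_).2.symm
    rw [List.prefix_iff_eq_take]
    apply List.ext_getElem?
    intro j
    simp only [List.getElem?_take, List.getElem?_drop, List.length_ofFn]
    by_cases hj : j < 8
    · have h1 : j < n := by omega
      rw [if_pos hj, if_pos h1, hwj j (by omega) (by omega), List.getElem?_ofFn,
        dif_pos (by omega)]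
    · rw [if_neg hj]
      simp; omega

/-! ### The result of the disassembly -/

theorem Disasm.len_pos {X : InstrSet} {C : List Byte} {i : DInstr} (h : Disasm X C i) :
    0 < i.len := by
  cases h with
  | label o _ _ => simp
  | cfiGuard o n r s h =>
    obtain ⟨-, n₁, n₂, n₃, rfl, h, -⟩ := h
    have := h.pos
    simp; omega
  | memGuard o n m h =>
    obtain ⟨n₁, n₂, rfl, h, -⟩ := h
    have := h.pos
    simp; omega
  | machine o n i h => exact h.pos

theorem Disasm.eq_label {X : InstrSet} {C : List Byte} {i : DInstr} (h : Disasm X C i)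
    (hl : LabelPos X C i.pos) : i = ⟨i.pos, 8, .cfiLabel⟩ ∧ i.pos + 8 ≤ C.length := by
  cases h with
  | label o _ h => exact ⟨rfl, h⟩
  | cfiGuard o n r s h =>
    obtain ⟨-, n₁, n₂, n₃, rfl, h, -⟩ := h
    cases h.eq_nop_of_labelPos hl
  | memGuard o n m h =>
    obtain ⟨n₁, n₂, rfl, h, -⟩ := h
    cases h.eq_nop_of_labelPos hl
  | machine o n i _ h => exact absurd hl h

/-- `R` is a set of disjoint instructions of `C` that contains all labels and is closed under
sequential execution and direct transfers. -/
structure IsDisassembly (X : InstrSet) (C : List Byte) (R : Set DInstr) : Prop where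
  disasm : ∀ i ∈ R, Disasm X C i
  disjoint : ∀ i ∈ R, ∀ j ∈ R, i.Overlaps j → i = j
  label : ∀ o, LabelPos X C o → ∃ i ∈ R, i.pos = o
  direct : ∀ i ∈ R, ∀ t, i.directTarget = some t → ∃ j ∈ R, (j.pos : ℤ) = t
  next : ∀ i ∈ R, ¬ i.IsUnconditional → ∃ j ∈ R, j.pos = i.pos + i.len
  pos_lt : ∀ i ∈ R, i.pos < C.length

/-- The address `a` has been visited by the disassembler or is scheduled. -/
def DisasmState.Covers (σ : DisasmState) (a : ℤ) : Prop :=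
  a ∈ σ.S ∨ σ.cur = some a ∨ ∃ j ∈ σ.R, (j.pos : ℤ) = a

/-- An address leaves `S` only to become `cur`, and `cur` is given up only once an instruction at it
is in `R`. -/
theorem DisasmStep.covers {X : InstrSet} {C : List Byte} {σ τ : DisasmState}
    (h : DisasmStep X C σ τ) {a : ℤ} (ha : σ.Covers a) : τ.Covers a := by
  unfold DisasmState.Covers at *
  cases h with
  | pop R S b hb =>
    by_cases hab : a = b
    · simp [hab]
    · rcases ha with h | h | h
      · exact .inl ⟨h, hab⟩
      · cases h
      · exact .inr (.inr h)
  | seen R S i _ _ hi =>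
    rcases ha with h | h | h
    · exact .inl h
    · exact .inr (.inr ⟨i, hi, by simpa using h⟩)
    · exact .inr (.inr h)
  | last R S i _ _ _ _ _ | next R S i _ _ _ _ _ =>
    rcases ha with h | h | ⟨j, hj, h⟩
    · exact .inl (.inl h)
    · exact .inr (.inr ⟨i, .inl rfl, by simpa using h⟩)
    · exact .inr (.inr ⟨j, .inr hj, h⟩)

/-- The invariant of the disassembly algorithm. -/
structure DisasmState.Valid (X : InstrSet) (C : List Byte) (σ : DisasmState) : Prop where
  disasm : ∀ i ∈ σ.R, Disasm X C i
  disjoint : ∀ i ∈ σ.R, ∀ j ∈ σ.R, i.Overlaps j → i = j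
  label : ∀ o : ℕ, LabelPos X C o → σ.Covers o
  direct : ∀ i ∈ σ.R, ∀ t, i.directTarget = some t → σ.Covers t
  next : ∀ i ∈ σ.R, ¬ i.IsUnconditional → σ.Covers (i.pos + i.len)
  pos_lt : ∀ i ∈ σ.R, i.pos < C.length

theorem DInstr.Overlaps.symm {i j : DInstr} (h : i.Overlaps j) : j.Overlaps i := ⟨h.2, h.1⟩

theorem DisasmState.Valid.insert {X : InstrSet} {C : List Byte} {σ τ : DisasmState} {i : DInstr}
    (h : σ.Valid X C) (hc : ∀ a, σ.Covers a → τ.Covers a) (hR : τ.R = insert i σ.R)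
    (hlt : i.pos < C.length) (hi : Disasm X C i) (hd : ∀ j ∈ σ.R, ¬ i.Overlaps j)
    (ht : ∀ t, i.directTarget = some t → τ.Covers t)
    (hn : ¬ i.IsUnconditional → τ.Covers (i.pos + i.len)) : τ.Valid X C where
  disasm := by rw [hR]; rintro j (rfl | hj); exacts [hi, h.disasm j hj]
  disjoint := by
    rw [hR]
    rintro j (rfl | hj) k (rfl | hk) hjk
    exacts [rfl, absurd hjk (hd k hk), absurd hjk.symm (hd j hj), h.disjoint j hj k hk hjk]
  label o ho := hc _ (h.label o ho)
  direct := by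
    rw [hR]; rintro j (rfl | hj) t hjt; exacts [ht t hjt, hc _ (h.direct j hj t hjt)]
  next := by rw [hR]; rintro j (rfl | hj) hu; exacts [hn hu, hc _ (h.next j hj hu)]
  pos_lt := by rw [hR]; rintro j (rfl | hj); exacts [hlt, h.pos_lt j hj]

theorem DisasmStep.valid {X : InstrSet} {C : List Byte} {σ τ : DisasmState}
    (h : DisasmStep X C σ τ) (hσ : σ.Valid X C) : τ.Valid X C := by
  have hc : ∀ a, σ.Covers a → τ.Covers a := fun a => h.covers
  cases h with
  | pop | seen =>
    exact ⟨hσ.disasm, hσ.disjoint, fun o ho => hc _ (hσ.label o ho),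
      fun i hi t ht => hc _ (hσ.direct i hi t ht), fun i hi hu => hc _ (hσ.next i hi hu),
      hσ.pos_lt⟩
  | last R S i hlt hi _ hd hu =>
    exact hσ.insert hc rfl hlt hi hd (fun t ht => .inl (.inr ht)) fun h => absurd hu h
  | next R S i hlt hi _ hd hu =>
    exact hσ.insert hc rfl hlt hi hd (fun t ht => .inl (.inr ht)) fun _ => .inr (.inl rfl)

theorem Stage1.isDisassembly {X : InstrSet} {C : List Byte} {R : Set DInstr}
    (h : Stage1 X C R) : IsDisassembly X C R := by
  have h0 : DisasmState.Valid X C ⟨∅, {a | ∃ o : ℕ, a = o ∧ LabelPos X C o}, none⟩ :=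
    ⟨by simp, by simp, fun o ho => .inl ⟨o, rfl, ho⟩, by simp, by simp, by simp⟩
  have hv : DisasmState.Valid X C ⟨R, ∅, none⟩ := by
    unfold Stage1 at h
    generalize (DisasmState.mk R ∅ none) = τ at h ⊢
    induction h with
    | refl => exact h0
    | tail _ hs ih => exact hs.valid ih
  -- On termination nothing is scheduled, so covered addresses carry instructions of `R`.
  have hc : ∀ a, DisasmState.Covers ⟨R, ∅, none⟩ a → ∃ j ∈ R, (j.pos : ℤ) = a := by
    rintro a (h | h | h)
    · exact absurd h (Set.notMem_empty _)
    · cases h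
    · exact h
  refine ⟨hv.disasm, hv.disjoint, fun o ho => ?_, fun i hi t ht => hc t (hv.direct i hi t ht),
    fun i hi hu => ?_, hv.pos_lt⟩
  · simpa using hc _ (hv.label o ho)
  · obtain ⟨j, hj, h⟩ := hc _ (hv.next i hi hu)
    exact ⟨j, hj, by exact_mod_cast h⟩

namespace IsDisassembly

variable {X : InstrSet} {C : List Byte} {R : Set DInstr}

theorem label_mem (h : IsDisassembly X C R) {o : ℕ} (ho : LabelPos X C o) :
    (⟨o, 8, .cfiLabel⟩ : DInstr) ∈ R ∧ o + 8 ≤ C.length := by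
  obtain ⟨i, hi, rfl⟩ := h.label o ho
  obtain ⟨h1, h2⟩ := (h.disasm i hi).eq_label ho
  exact ⟨h1 ▸ hi, h2⟩

/-- Nonempty instructions with a common end share their last byte, hence overlap. This identifies
the instruction executed before a register-based transfer with its guard. -/
theorem eq_of_end_eq (h : IsDisassembly X C R) {i j : DInstr} (hi : i ∈ R) (hj : j ∈ R)
    (he : i.pos + i.len = j.pos + j.len) : i = j := by
  have h1 := (h.disasm i hi).len_pos
  have h2 := (h.disasm j hj).len_pos
  exact h.disjoint i hi j hj ⟨by omega, by omega⟩

/-- The bytes of an instruction are not rewritten by the loader, unless it is a label. -/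
theorem not_rewritten (h : IsDisassembly X C R) {i : DInstr} (hi : i ∈ R)
    (hne : i.op ≠ .cfiLabel) {p o : ℕ} (h1 : i.pos ≤ p) (h2 : p < i.pos + i.len)
    (ho : LabelPos X C o) : ¬ (o + 4 ≤ p ∧ p < o + 8) := by
  rintro ⟨h3, h4⟩
  have := h.disjoint i hi _ (h.label_mem ho).1 ⟨by simp; omega, by simp; omega⟩
  subst this
  exact hne rfl

end IsDisassembly

/-! ### Loaded code -/

theorem InstrSet.label_of_lt (X : InstrSet) (id : Fin 4 → Byte) {j : ℕ} (h : j < 4) :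
    X.label id ⟨j, by omega⟩ = X.magic ⟨j, h⟩ :=
  Fin.append_left X.magic id ⟨j, h⟩

theorem InstrSet.label_add (X : InstrSet) (id : Fin 4 → Byte) {j : ℕ} (h : j < 4) :
    X.label id ⟨4 + j, by omega⟩ = id ⟨j, h⟩ :=
  Fin.append_right X.magic id ⟨j, h⟩

theorem InstrSet.label_injective (X : InstrSet) : Function.Injective X.label := by
  intro a b h
  funext ⟨j, hj⟩
  rw [← X.label_add a hj, ← X.label_add b hj, h]

theorem LabelAt.id_eq {X : InstrSet} {mem : Mem} {a : Addr} {x y : Fin 4 → Byte}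
    (hx : LabelAt X mem a x) (hy : LabelAt X mem a y) : x = y :=
  X.label_injective (funext fun j => (hx j).symm.trans (hy j))

theorem labelAt_of_load64_eq {X : InstrSet} {mem : Mem} {a : Addr} {id : Fin 4 → Byte}
    (h : load64 mem a = le64 (X.label id)) : LabelAt X mem a id :=
  fun j => congrFun (le64_injective h) j

theorem LabelAt.decode {X : InstrSet} {mem : Mem} {a : Addr} {id : Fin 4 → Byte}
    (h : LabelAt X mem a id) : X.enc (readBytes mem a 8) = some .nop := by
  rw [← X.enc_label id]
  congr 1
  apply List.ext_getElem (by simp [readBytes])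
  intro j h1 h2
  have hj : j < 8 := by simpa using h2
  rw [List.getElem_ofFn]
  simpa [readBytes, InstrSet.label] using h ⟨j, hj⟩

namespace Loaded

variable {X : InstrSet} {D : Domain} {C : List Byte} {mem : Mem} {R : Set DInstr}

theorem label_byte (h : Loaded X D C mem) (hR : IsDisassembly X C R) {o : ℕ}
    (ho : LabelPos X C o) {j : ℕ} (hj : j < 8) :
    mem (addr (D.codeBegin + (o + j))) = X.label D.id ⟨j, hj⟩ := by
  obtain ⟨hm, hlen⟩ := hR.label_mem ho
  rcases lt_or_ge j 4 with h4 | h4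
  · rw [X.label_of_lt D.id h4, h.code (o + j) (by omega)]
    · have := ho ⟨j, h4⟩
      simpa [List.getElem?_eq_getElem (show o + j < C.length by omega)] using this
    -- A label whose ID field contained this byte would overlap the label at `o`, hence equal it;
    -- but the byte is among the first four.
    · rintro o' ho' ⟨h1, h2⟩
      have := congrArg DInstr.pos
        (hR.disjoint _ hm _ (hR.label_mem ho').1 ⟨by simp; omega, by simp; omega⟩)
      simp at this
      omega
  · obtain ⟨k, rfl⟩ := Nat.exists_eq_add_of_le h4
    rw [X.label_add D.id (by omega : k < 4), ← h.labels o ho ⟨k, by omega⟩, add_assoc o]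

theorem labelAt (h : Loaded X D C mem) (hR : IsDisassembly X C R) {o : ℕ}
    (ho : LabelPos X C o) : LabelAt X mem (addr (D.codeBegin + o)) D.id := by
  intro j
  rw [addr_add, add_assoc, h.label_byte hR ho j.isLt]

theorem decode (h : Loaded X D C mem) {o n : ℕ} {i : Instr} (hi : MachineAt X C o i n)
    (hs : ∀ p, o ≤ p → p < o + n → ∀ o', LabelPos X C o' → ¬ (o' + 4 ≤ p ∧ p < o' + 8)) :
    X.enc (readBytes mem (addr (D.codeBegin + o)) n) = some i := by
  obtain ⟨hn, he⟩ := hi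
  rw [← he]
  congr 1
  apply List.ext_getElem (by simp [readBytes]; omega)
  intro j h1 h2
  have hj : j < n := by simpa [readBytes] using h1
  simp only [readBytes, List.getElem_map, List.getElem_range, List.getElem_take,
    List.getElem_drop, addr_add, add_assoc]
  exact h.code (o + j) (by omega) (hs _ (by omega) (by omega))

/-- In a loaded code segment, the magic bytes occur only at the labels of the original code. -/
theorem labelPos (h : Loaded X D C mem) (hR : IsDisassembly X C R)
    (safe : ∀ j : ℕ, 1 ≤ j → j < 8 →
      ¬ ∀ (i : Fin 4) (h : j + i < 8), X.label D.id ⟨j + i, h⟩ = X.magic i)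
    {o : ℕ} (ho : o + 4 ≤ C.length)
    (hm : ∀ j : Fin 4, mem (addr (D.codeBegin + (o + j))) = X.magic j) : LabelPos X C o := by
  -- Either `o` lies strictly inside an original label, which `safe` excludes, or none of the four
  -- bytes is in a rewritten ID field and they come unchanged from `C`.
  by_cases hr : ∃ o', LabelPos X C o' ∧ o' < o ∧ o < o' + 8
  · obtain ⟨o', ho', h1, h2⟩ := hr
    refine absurd (fun i hi => ?_) (safe (o - o') (by omega) (by omega))
    rw [← h.label_byte hR ho' hi, ← hm i]
    congr 3
    omega
  · intro j
    have hj := j.isLt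
    rw [List.getElem?_eq_getElem (by omega), ← hm j, h.code]
    rintro o' ho' ⟨h1, h2⟩
    exact hr ⟨o', ho', by omega, by omega⟩

end Loaded

/-! ### Labels of a domain -/

namespace Enclave

variable {X : InstrSet} {ι : Type*} (E : Enclave X ι) (d : ι) (C : List Byte)

/-- `a` is the address of a label of the domain `d` in which `C` is loaded: the beginning of the
trampoline, or a label in the code segment. -/
def IsLoadedLabel (a : Addr) : Prop :=
  a = addr (E.dom d).tramp ∨ ∃ o, LabelPos X C o ∧ a = addr ((E.dom d).codeBegin + o)

/-- A register-based transfer to `a` reaches a label or is detected. -/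
def SafeTarget (a : Addr) : Prop :=
  E.FetchFaults a ∨ E.IsLoadedLabel d C a

variable {E d C}

theorem codeEnd_lt : (E.dom d).codeEnd < 2 ^ 64 := by
  have h1 := E.data_eq d
  have h2 := E.data_lt d
  have h3 := E.bounded d
  omega

theorem CodeIntact.loaded {mem : Mem} (h : E.CodeIntact d C mem) : Loaded X (E.dom d) C mem := by
  obtain ⟨img, rfl, h, -⟩ := h
  exact (h d).2

/-- A label in executable memory is at some trampoline or begins in some loaded segment, and there
the loader has written the ID of the owning domain. Injectivity of IDs makes `d` the owner. -/
theorem CodeIntact.isLoadedLabel {mem : Mem} {a : Addr} (h : E.CodeIntact d C mem)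
    (ha : E.Executable a) (hl : LabelAt X mem a (E.dom d).id) : E.IsLoadedLabel d C a := by
  obtain ⟨img, rfl, himg, hlab⟩ := h
  rcases hlab a d ha hl with ⟨e, rfl⟩ | ⟨e, h1, h2⟩
  · obtain rfl := E.id_injective ((himg e).2.tramp.id_eq hl)
    exact .inl rfl
  · obtain ⟨⟨R, hR, -⟩, hL⟩ := himg e
    have hR := hR.isDisassembly
    obtain ⟨o, ho⟩ := Nat.exists_eq_add_of_le h1
    have hao : a = addr ((E.dom e).codeBegin + o) := by rw [← ho, ← eq_addr_toNat]
    have hpos : LabelPos X (img e) o := by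
      refine hL.labelPos hR (E.id_safe e) (by omega) fun j => ?_
      have := hl (Fin.castAdd 4 j)
      rw [hao, addr_add] at this
      rw [← add_assoc]
      exact this.trans (X.label_of_lt _ j.isLt)
    have he : e = d := E.id_injective (LabelAt.id_eq (hao ▸ hL.labelAt hR hpos) hl)
    subst he
    exact .inr ⟨o, hpos, hao⟩

/-- Returns from the memory-independent description of a label to actual memory, at any moment when
the code is intact. -/
theorem IsLoadedLabel.isCfiLabel {R : Set DInstr} {mem : Mem} {a : Addr}
    (h : E.IsLoadedLabel d C a) (hR : IsDisassembly X C R) (hm : E.CodeIntact d C mem) :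
    E.IsCfiLabel d mem a := by
  have hL := hm.loaded
  have h1 := E.tramp_mem d
  have h2 := codeEnd_lt (E := E) (d := d)
  have h3 := hL.fits
  rcases h with rfl | ⟨o, ho, rfl⟩
  · refine ⟨hL.tramp, ?_⟩
    rw [toNat_addr (by omega)]
    omega
  · have h4 := (hR.label_mem ho).2
    refine ⟨hL.labelAt hR ho, ?_⟩
    rw [toNat_addr (by omega)]
    omega

theorem IsCfiLabel.inCode {mem : Mem} {a : Addr} (h : E.IsCfiLabel d mem a) :
    (E.dom d).InCode a := ⟨h.2.1, by have := h.2.2; omega⟩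

theorem CodeIntact.safeTarget {mem : Mem} {a : Addr} (h : E.CodeIntact d C mem)
    (hl : load64 mem a = le64 (X.label (E.dom d).id)) : E.SafeTarget d C a := by
  by_cases ha : E.Executable a
  · exact .inr (h.isLoadedLabel ha (labelAt_of_load64_eq hl))
  · exact .inl ha

/-! ### The invariant of an execution -/

variable (E d C)

/-- Address of the offset `o` of the loaded code segment. -/
def codeAddr (o : ℕ) : Addr := addr ((E.dom d).codeBegin + o)

/-- Where the domain can be between two instructions, and what is known there. -/
inductive Location (R : Set DInstr) (s : State) : Prop where
  | fault : E.FetchFaults s.pc → Location R s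
  | tramp : s.pc = addr (E.dom d).tramp → Location R s
  | start (i : DInstr) : i ∈ R → s.pc = E.codeAddr d i.pos →
      (∀ m r, i.op = .machine m → m.targetReg = some r → E.SafeTarget d C (s.regs r)) →
      Location R s
  /-- inside of a `cfi_guard`, after the load -/
  | guardLoaded (i : DInstr) (r t : Reg) (p n₂ n₃ : ℕ) : i ∈ R → i.op = .cfiGuard r t →
      i.pos ≤ p → p + n₂ + n₃ = i.pos + i.len →
      MachineAt X C p (.bndcl 1 (.reg t)) n₂ →
      MachineAt X C (p + n₂) (.bndcu 1 (.reg t)) n₃ → s.pc = E.codeAddr d p →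
      (s.regs t = le64 (X.label (E.dom d).id) → E.SafeTarget d C (s.regs r)) → Location R s
  /-- inside of a `cfi_guard`, after the check against the lower bound -/
  | guardLower (i : DInstr) (r t : Reg) (p n₃ : ℕ) : i ∈ R → i.op = .cfiGuard r t →
      i.pos ≤ p → p + n₃ = i.pos + i.len →
      MachineAt X C p (.bndcu 1 (.reg t)) n₃ → s.pc = E.codeAddr d p →
      le64 (X.label (E.dom d).id) ≤ s.regs t →
      (s.regs t = le64 (X.label (E.dom d).id) → E.SafeTarget d C (s.regs r)) → Location R s
  /-- inside of a `mem_guard`, after the check against the lower bound -/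
  | memGuard (i : DInstr) (m : MemOperand) (p n₂ : ℕ) : i ∈ R → i.op = .memGuard m →
      i.pos ≤ p → p + n₂ = i.pos + i.len →
      MachineAt X C p (.bndcu 0 (.mem m)) n₂ → s.pc = E.codeAddr d p → Location R s

/-- The invariant of an execution. -/
def Inv (R : Set DInstr) (s : State) : Prop :=
  s.bnd 1 = (le64 (X.label (E.dom d).id), le64 (X.label (E.dom d).id)) ∧ E.Location d C R s

variable {E d C} {R : Set DInstr} {s s' : State}

theorem codeAddr_add (o n : ℕ) : E.codeAddr d o + addr n = E.codeAddr d (o + n) := by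
  rw [codeAddr, codeAddr, addr_add, add_assoc]

theorem location_of_isLoadedLabel (hR : IsDisassembly X C R)
    (h : E.IsLoadedLabel d C s.pc) : E.Location d C R s := by
  rcases h with h | ⟨o, ho, h⟩
  · exact .tramp h
  · exact .start _ (hR.label_mem ho).1 h (by simp)

theorem location_of_safeTarget (hR : IsDisassembly X C R)
    (h : E.SafeTarget d C s.pc) : E.Location d C R s := by
  rcases h with h | h
  · exact .fault h
  · exact location_of_isLoadedLabel hR h

/-- `Location` does not mention memory, so outside interference with memory is harmless. -/
theorem Location.of_regs_eq (h : E.Location d C R s) (hpc : s'.pc = s.pc)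
    (hregs : s'.regs = s.regs) : E.Location d C R s' := by
  cases h with
  | fault h => exact .fault (hpc ▸ h)
  | tramp h => exact .tramp (hpc ▸ h)
  | start i hi h1 h2 => exact .start i hi (hpc ▸ h1) (hregs ▸ h2)
  | guardLoaded i r t p n₂ n₃ hi ho h1 h2 h3 h4 h5 h6 =>
    exact .guardLoaded i r t p n₂ n₃ hi ho h1 h2 h3 h4 (hpc ▸ h5) (hregs ▸ h6)
  | guardLower i r t p n₃ hi ho h1 h2 h3 h4 h5 h6 =>
    exact .guardLower i r t p n₃ hi ho h1 h2 h3 (hpc ▸ h4) (hregs ▸ h5) (hregs ▸ h6)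
  | memGuard i m p n₂ hi ho h1 h2 h3 h4 => exact .memGuard i m p n₂ hi ho h1 h2 h3 (hpc ▸ h4)

/-- Sequential execution past the end of a disassembled instruction. -/
theorem location_next (hR : IsDisassembly X C R) (h3 : Stage3 R) {i : DInstr} (hi : i ∈ R)
    (hu : ¬ i.IsUnconditional) (hpc : s.pc = E.codeAddr d (i.pos + i.len))
    (hg : ∀ r t, i.op = .cfiGuard r t → E.SafeTarget d C (s.regs r)) :
    E.Location d C R s := by
  obtain ⟨j, hj, hji⟩ := hR.next i hi hu
  refine .start j hj (hji ▸ hpc) fun m r hm hr => ?_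
  -- If the next instruction is a register-based transfer, its guard ends where `i` ends; so `i` is
  -- that guard.
  obtain ⟨g, hgR, ⟨t, hgt⟩, hgj⟩ := h3.regBased j hj m r hm hr
  obtain rfl := hR.eq_of_end_eq hgR hi (hgj.trans hji)
  exact hg r t hgt

/-- The machine instruction at an offset inside of a disassembled instruction is executed as it
stands in the code segment. -/
theorem UserStep.instr_eq {i : Instr} {n : ℕ} (hs : E.UserStep d i n s s')
    (hR : IsDisassembly X C R) (hm : E.CodeIntact d C s.mem) {k : DInstr} (hk : k ∈ R)
    (hop : k.op ≠ .cfiLabel) {p l : ℕ} {m : Instr} (hp : MachineAt X C p m l)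
    (h1 : k.pos ≤ p) (h2 : p + l ≤ k.pos + k.len) (hpc : s.pc = E.codeAddr d p) :
    i = m ∧ n = l := by
  have := hm.loaded.decode hp fun q hq1 hq2 o ho =>
    hR.not_rewritten hk hop (by omega) (by omega) ho
  rw [codeAddr] at hpc
  have := X.decode_unique hs.decode (hpc ▸ this)
  exact ⟨this.2, this.1⟩

end Enclave

/-! ### Execution of one instruction. -/

theorem Instr.not_isControlTransfer {i : Instr} (hd : i.directDisp = none)
    (hr : i.targetReg = none) (h1 : i ≠ .jmpMem) (h2 : i ≠ .callMem) (h3 : i ≠ .ret) :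
    ¬ i.IsControlTransfer := by
  simp [IsControlTransfer, IsDirect, IsRegBased, IsMemBased, IsReturn, hd, hr, h1, h2, h3]

theorem DInstr.not_isUnconditional {i : DInstr} {m : Instr} (h : i.op = .machine m)
    (hm : ¬ m.IsUnconditional) : ¬ i.IsUnconditional := by
  rintro ⟨m', h', hm'⟩
  rw [h] at h'
  cases h'
  exact hm hm'

namespace Enclave

variable {X : InstrSet} {ι : Type*} {E : Enclave X ι} {d : ι} {C : List Byte} {R : Set DInstr}
  {s s' : State}

/-- What the execution of an instruction `i` that leads to the state `s'` guarantees. -/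
def TransferOk (E : Enclave X ι) (d : ι) (C : List Byte) (i : Instr) (s' : State) : Prop :=
  (i.IsRegBased → E.SafeTarget d C s'.pc) ∧
    (i.IsControlTransfer → i.IsRegBased ∨ (E.dom d).InCode s'.pc)

theorem TransferOk.of_not_controlTransfer {i : Instr} (h : ¬ i.IsControlTransfer) :
    E.TransferOk d C i s' :=
  ⟨fun hr => absurd (.inr (.inl hr)) h, fun hc => absurd hc h⟩

theorem TransferOk.of_isRegBased {i : Instr} (h : i.IsRegBased) (hs : E.SafeTarget d C s'.pc) :
    E.TransferOk d C i s' :=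
  ⟨fun _ => hs, fun _ => .inl h⟩

theorem TransferOk.of_inCode {i : Instr} (h : ¬ i.IsRegBased) (hs : (E.dom d).InCode s'.pc) :
    E.TransferOk d C i s' :=
  ⟨fun hr => absurd hr h, fun _ => .inr hs⟩

theorem inCode_codeAddr {mem : Mem} (hm : E.CodeIntact d C mem) {o : ℕ} (ho : o < C.length) :
    (E.dom d).InCode (E.codeAddr d o) := by
  have h1 := E.tramp_mem d
  have h2 := codeEnd_lt (E := E) (d := d)
  have h3 := hm.loaded.fits
  rw [codeAddr, Domain.InCode, toNat_addr (by omega)]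
  omega

/-- A direct transfer reaches an instruction found by the disassembler. -/
theorem location_direct (hR : IsDisassembly X C R) (h3 : Stage3 R) {i : DInstr} (hi : i ∈ R)
    {m : Instr} {disp : ℤ} (hm : i.op = .machine m) (hd : m.directDisp = some disp)
    (hpc : s'.pc = E.codeAddr d i.pos + addr i.len + BitVec.ofInt 64 disp) {mem : Mem}
    (hI : E.CodeIntact d C mem) : E.Location d C R s' ∧ (E.dom d).InCode s'.pc := by
  have ht : i.directTarget = some ((i.pos : ℤ) + i.len + disp) := by
    simp [DInstr.directTarget, DInstr.machine?, hm, hd]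
  obtain ⟨j, hj, hjt⟩ := hR.direct i hi _ ht
  have hpc' : s'.pc = E.codeAddr d j.pos := by
    rw [hpc, codeAddr_add, codeAddr, codeAddr]
    exact addr_add_ofInt _ _ _ (by push_cast; omega)
  refine ⟨.start j hj hpc' fun m' r hm' hr => ?_, hpc' ▸ inCode_codeAddr hI (hR.pos_lt j hj)⟩
  -- The target is not a register-based transfer by Stage 3, so nothing is owed about registers.
  exact absurd (by simp [Instr.IsRegBased, hr]) (h3.direct i hi _ ht j hj hjt m' hm')

/-- Execution of a single machine instruction that is not part of a guard. -/
theorem inv_machine (hR : IsDisassembly X C R) (h2 : Stage2 R) (h3 : Stage3 R)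
    (hm : E.CodeIntact d C s.mem) {j : DInstr} (hj : j ∈ R) {i : Instr} (hop : j.op = .machine i)
    (hpc : s.pc = E.codeAddr d j.pos)
    (hb : s.bnd 1 = (le64 (X.label (E.dom d).id), le64 (X.label (E.dom d).id)))
    (hsafe : ∀ r, i.targetReg = some r → E.SafeTarget d C (s.regs r))
    (he : Effect i j.len s s') : E.Inv d C R s' ∧ E.TransferOk d C i s' := by
  -- Three patterns cover all instructions admitted by Stages 2 and 3: sequential, direct (`dir`)
  -- and register-based (`ind`).
  have seq : ¬ i.IsControlTransfer → s'.pc = s.pc + addr j.len → s'.bnd = s.bnd →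
      E.Inv d C R s' ∧ E.TransferOk d C i s' := by
    intro hc hpc' hb'
    refine ⟨⟨hb' ▸ hb, location_next hR h3 hj ?_ ?_ (by simp [hop])⟩,
      .of_not_controlTransfer hc⟩
    · exact DInstr.not_isUnconditional hop fun h => hc h.1
    · rw [hpc', hpc, codeAddr_add]
  have dir : ∀ disp, i.directDisp = some disp → ¬ i.IsRegBased →
      s'.pc = s.pc + addr j.len + BitVec.ofInt 64 disp → s'.bnd = s.bnd →
      E.Inv d C R s' ∧ E.TransferOk d C i s' := by
    intro disp hd hr hpc' hb'
    obtain ⟨hl, hc⟩ := location_direct hR h3 hj hop hd (hpc ▸ hpc') hm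
    exact ⟨⟨hb' ▸ hb, hl⟩, .of_inCode hr hc⟩
  have ind : ∀ r, i.targetReg = some r → s'.pc = s.regs r → s'.bnd = s.bnd →
      E.Inv d C R s' ∧ E.TransferOk d C i s' := by
    intro r hr hpc' hb'
    have hs : E.SafeTarget d C s'.pc := hpc' ▸ hsafe r hr
    exact ⟨⟨hb' ▸ hb, location_of_safeTarget hR hs⟩,
      .of_isRegBased (by simp [Instr.IsRegBased, hr]) hs⟩
  cases i with
  | nop =>
    exact seq (Instr.not_isControlTransfer rfl rfl (by simp) (by simp) (by simp))
      (by rw [he]) (by rw [he])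
  | load =>
    exact seq (Instr.not_isControlTransfer rfl rfl (by simp) (by simp) (by simp))
      (by rw [he]) (by rw [he])
  | bndcl =>
    exact seq (Instr.not_isControlTransfer rfl rfl (by simp) (by simp) (by simp))
      (by rw [he.2]) (by rw [he.2])
  | bndcu =>
    exact seq (Instr.not_isControlTransfer rfl rfl (by simp) (by simp) (by simp))
      (by rw [he.2]) (by rw [he.2])
  | other =>
    exact seq (Instr.not_isControlTransfer rfl rfl (by simp) (by simp) (by simp))
      he.1 he.2
  | jmp disp => exact dir disp rfl (by simp [Instr.IsRegBased, Instr.targetReg]) he.1 he.2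
  | call disp => exact dir disp rfl (by simp [Instr.IsRegBased, Instr.targetReg]) he.1 he.2
  | jcc disp =>
    obtain ⟨hpc' | hpc', hb'⟩ := he
    · exact dir disp rfl (by simp [Instr.IsRegBased, Instr.targetReg]) hpc' hb'
    · have hu : ¬ j.IsUnconditional :=
        DInstr.not_isUnconditional hop fun h => h.2 disp rfl
      -- A branch not taken also stays in the code region, because an instruction of `R` begins
      -- right behind it.
      obtain ⟨k, hk, hkj⟩ := hR.next j hj hu
      have hpc'' : s'.pc = E.codeAddr d (j.pos + j.len) := by rw [hpc', hpc, codeAddr_add]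
      refine ⟨⟨hb' ▸ hb, location_next hR h3 hj hu hpc'' (by simp [hop])⟩,
        .of_inCode (by simp [Instr.IsRegBased, Instr.targetReg]) ?_⟩
      rw [hpc'', ← hkj]
      exact inCode_codeAddr hm (hR.pos_lt k hk)
  | jmpReg r => exact ind r rfl he.1 he.2
  | callReg r => exact ind r rfl he.1 he.2
  | jmpMem => exact absurd (.inl rfl) (h3.memBased j hj _ hop)
  | callMem => exact absurd (.inr rfl) (h3.memBased j hj _ hop)
  | ret => exact absurd rfl (h3.returnBased j hj _ hop)
  | dangerous k => exact absurd hop (h2 j hj k)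

/-- Every instruction executed by the domain preserves the invariant, and its transfer of control
is allowed. -/
theorem UserStep.inv {i : Instr} {n : ℕ} (hs : E.UserStep d i n s s')
    (hR : IsDisassembly X C R) (h2 : Stage2 R) (h3 : Stage3 R) (hm : E.CodeIntact d C s.mem)
    (h : E.Inv d C R s) : E.Inv d C R s' ∧ E.TransferOk d C i s' := by
  obtain ⟨hb, hloc⟩ := h
  have nu : ∀ {k : DInstr}, (∀ m, k.op ≠ .machine m) → ¬ k.IsUnconditional :=
    fun hk ⟨m, hkm, _⟩ => hk m hkm
  cases hloc with
  | fault h =>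
    -- Encodings are nonempty, so a byte at the program counter itself is fetched.
    have := hs.fetch 0 (X.decode_pos hs.decode)
    exact absurd (by simpa [addr] using this) h
  | tramp h =>
    have h1 := E.tramp_mem d
    have h4 := codeEnd_lt (E := E) (d := d)
    refine absurd ?_ hs.not_tramp
    rw [h, Domain.InTramp, toNat_addr (by omega)]
    omega
  | start j hj hpc hsafe =>
    cases hR.disasm j hj with
    | label o ho hlen =>
      -- Memory differs from `C` in the ID bytes, so decoding goes through the rewritten label.
      have hd := (hm.loaded.labelAt hR ho).decode
      obtain ⟨rfl, rfl⟩ := X.decode_unique hs.decode (by rw [hpc]; exact hd)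
      have he : s' = { s with pc := s.pc + addr 8 } := hs.effect
      subst he
      refine ⟨⟨hb, location_next hR h3 hj (nu (by simp)) ?_ (by simp)⟩,
        .of_not_controlTransfer ?_⟩
      · simp only [hpc, codeAddr_add]
      · exact Instr.not_isControlTransfer rfl rfl (by simp) (by simp) (by simp)
    | cfiGuard o l r t hg =>
      obtain ⟨hrt, n₁, n₂, n₃, rfl, g1, g2, g3⟩ := hg
      obtain ⟨rfl, rfl⟩ := hs.instr_eq hR hm hj (by simp) g1 le_rfl (by simp; omega) hpc
      have he : s' = _ := hs.effect
      subst he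
      refine ⟨⟨hb, .guardLoaded _ r t (o + n) n₂ n₃ hj rfl (by simp) (by simp; omega) g2 g3
        ?_ ?_⟩, .of_not_controlTransfer ?_⟩
      · simp only [hpc, codeAddr_add]
      -- The scratch register differs from `r`, so the load leaves the address in `r` intact.
      · simp only [Function.update_self, Function.update_of_ne hrt.symm]
        exact hm.safeTarget
      · exact Instr.not_isControlTransfer rfl rfl (by simp) (by simp) (by simp)
    | memGuard o l m hg =>
      obtain ⟨n₁, n₂, rfl, g1, g2⟩ := hg
      obtain ⟨rfl, rfl⟩ := hs.instr_eq hR hm hj (by simp) g1 le_rfl (by simp) hpc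
      obtain ⟨-, rfl⟩ := hs.effect
      exact ⟨⟨hb, .memGuard _ m (o + n) n₂ hj rfl (by simp) (by simp; omega) g2
        (by simp only [hpc, codeAddr_add])⟩,
      .of_not_controlTransfer
        (Instr.not_isControlTransfer rfl rfl (by simp) (by simp) (by simp))⟩
    | machine o l m hmach _ _ _ =>
      obtain ⟨rfl, rfl⟩ := hs.instr_eq hR hm hj (by simp) hmach le_rfl le_rfl hpc
      exact inv_machine hR h2 h3 hm hj rfl hpc hb (fun r hr => hsafe _ r rfl hr) hs.effect
  | guardLoaded j r t p n₂ n₃ hj hop h4 h5 g2 g3 hpc hsafe =>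
    obtain ⟨rfl, rfl⟩ := hs.instr_eq hR hm hj (by simp [hop]) g2 h4 (by omega) hpc
    obtain ⟨hle, rfl⟩ := hs.effect
    rw [hb] at hle
    exact ⟨⟨hb, .guardLower j r t (p + n) n₃ hj hop (by omega) h5 g3
      (by simp only [hpc, codeAddr_add]) hle hsafe⟩,
      .of_not_controlTransfer
        (Instr.not_isControlTransfer rfl rfl (by simp) (by simp) (by simp))⟩
  | guardLower j r t p n₃ hj hop h4 h5 g3 hpc hle hsafe =>
    obtain ⟨rfl, rfl⟩ := hs.instr_eq hR hm hj (by simp [hop]) g3 h4 h5.le hpc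
    obtain ⟨hle', rfl⟩ := hs.effect
    rw [hb] at hle'
    refine ⟨⟨hb, location_next hR h3 hj (nu (by simp [hop]))
      (by simp only [hpc, codeAddr_add, h5]) fun r' t' h => ?_⟩,
      .of_not_controlTransfer
        (Instr.not_isControlTransfer rfl rfl (by simp) (by simp) (by simp))⟩
    rw [hop] at h
    cases h
    -- Both bounds of `bnd1` are the label value, so the two checks force equality.
    exact hsafe (BitVec.le_antisymm hle' hle)
  | memGuard j m p n₂ hj hop h4 h5 g2 hpc =>
    obtain ⟨rfl, rfl⟩ := hs.instr_eq hR hm hj (by simp [hop]) g2 h4 h5.le hpc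
    obtain ⟨-, rfl⟩ := hs.effect
    exact ⟨⟨hb, location_next hR h3 hj (nu (by simp [hop]))
      (by simp only [hpc, codeAddr_add, h5]) (by simp [hop])⟩,
      .of_not_controlTransfer
        (Instr.not_isControlTransfer rfl rfl (by simp) (by simp) (by simp))⟩

/-! ### Induction along an execution. -/

theorem Entry.inv (h : E.Entry d s) (hR : IsDisassembly X C R) (hm : E.CodeIntact d C s.mem) :
    E.Inv d C R s :=
  ⟨h.bnd1, location_of_isLoadedLabel hR (hm.isLoadedLabel (.inl ⟨d, h.pc_mem⟩) h.pc_label)⟩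

theorem IsTrace.inv {N : ℕ} {σ : ℕ → State} {act : ℕ → Action} (h : E.IsTrace d C N σ act)
    (hR : IsDisassembly X C R) (h2 : Stage2 R) (h3 : Stage3 R) {k : ℕ} (hk : k ≤ N) :
    E.Inv d C R (σ k) := by
  induction k with
  | zero => exact h.init.inv hR (h.intact 0 hk)
  | succ k ih =>
    have ih := ih (by omega)
    have hs := h.step k hk
    generalize act k = a at hs
    cases a with
    | user i n => exact (UserStep.inv hs hR h2 h3 (h.intact k (by omega)) ih).1
    | env =>
      obtain ⟨hpc, hregs, hb⟩ := hs
      exact ⟨hb ▸ ih.1, ih.2.of_regs_eq hpc hregs⟩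
    | libos => exact Entry.inv hs hR (h.intact _ hk)

end Enclave

end Mmdsfi

theorem mainTheorem1 {X : Mmdsfi.InstrSet} {ι : Type*} (E : Mmdsfi.Enclave X ι) (d : ι)
    (C : List Mmdsfi.Byte) (hC : Mmdsfi.PassesStages123 X C)
    (N : ℕ) (s : ℕ → Mmdsfi.State) (act : ℕ → Mmdsfi.Action) (hs : E.IsTrace d C N s act)
    (k : ℕ) (hk : k < N) (i : Mmdsfi.Instr) (n : ℕ) (hact : act k = .user i n) :
    (i.IsRegBased →
      E.IsCfiLabel d (s (k + 1)).mem (s (k + 1)).pc ∨ E.FetchFaults (s (k + 1)).pc) ∧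
    (i.IsControlTransfer →
      (E.dom d).InCode (s (k + 1)).pc ∨ (i.IsRegBased ∧ E.FetchFaults (s (k + 1)).pc)) := by
  obtain ⟨R, hR, h2, h3⟩ := hC
  have hR := hR.isDisassembly
  have hstep := hs.step k hk
  rw [hact] at hstep
  obtain ⟨-, hreg, hct⟩ :=
    Mmdsfi.Enclave.UserStep.inv hstep hR h2 h3 (hs.intact k hk.le) (hs.inv hR h2 h3 hk.le)
  have hlabel : i.IsRegBased →
      E.IsCfiLabel d (s (k + 1)).mem (s (k + 1)).pc ∨ E.FetchFaults (s (k + 1)).pc := fun hi =>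
    -- The label is read off in the memory after the transfer.
    (hreg hi).symm.imp_left fun h => h.isCfiLabel hR (hs.intact _ hk)
  refine ⟨hlabel, fun hc => ?_⟩
  rcases hct hc with hi | hi
  · exact (hlabel hi).imp (fun h => h.inCode) fun h => ⟨hi, h⟩
  · exact .inl hi
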